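/- Let $V$ be an infinite set and let $\phi:V\to\mathbb R^2$ be such that the open disks ("pennies") $B_v$ of radius $\tfrac12$ centered at $\phi(v)$, $v\in V$, are pairwise disjoint. Let $(V,E)$ be the contact graph, in which $v\neq w$ are adjacent if and only if the bounding circles of $B_v$ and $B_w$ are tangent (equivalently $|\phi(v)\phi(w)|=1$). Assume that $(V,E)$ is connected and let $d$ be its combinatorial distance. Let $S\subset\mathbb R^2$ be the union of all centers $\phi(v)$ and of all segments $\overline{\phi(v)\phi(w)}$ with $\{v,w\}\in E$. The faces are the connected components of $\mathbb R^2\setminus S$, and the degree $\deg(\sigma)\in\mathbb N\cup\{\infty\}$ of a face $\sigma$ is its number of corners (interior angles), i.e. the number of pairs $(v,A)$ where $v\in V$ and $A$ is a connected component of $B_v\setminus S$ with $A\subset\sigma$. Let $D\ge 0$ be a real number such that $\deg(\sigma)\le D$ for every face $\sigma$. Then for all $x,y\in V$ $$\frac1{2D}\,d(x,y)\le|\phi(x)\phi(y)|\le d(x,y).$$ Moreover, for every $z\in\mathbb R^2$ there is $x\in V$ with $|z\,\phi(x)|\le D/2$. Finally, $\phi$ is a quasi-isometry from $(V,d)$ to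 $(\mathbb R^2,|\cdot|)$: there are $a\ge1$ and $C>0$ such that $a^{-1}d(x,y)-C\le|\phi(x)\phi(y)|\le a\,d(x,y)+C$ for all $x,y\in V$, and every $z\in\mathbb R^2$ satisfies $|z\,\phi(x)|<C$ for some $x\in V$. -/

import Mathlib

open scoped ENNReal NNReal

/-- The Euclidean plane. -/
abbrev Plane : Type := EuclideanSpace ℝ (Fin 2)

/-- A configuration of non-overlapping pennies (open disks of radius `1/2`) in the plane,
indexed by `V` and recorded by their centers. -/
structure PennyConfiguration (V : Type*) where
  /-- the center of each penny -/
  center : V → Plane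
  /-- distinct pennies are disjoint -/
  disjoint_pennies : ∀ v w : V, v ≠ w →
    Disjoint (Metric.ball (center v) (1 / 2)) (Metric.ball (center w) (1 / 2))

namespace PennyConfiguration

variable {V : Type*}

/-- The penny (open disk) at `v`. -/
def penny (P : PennyConfiguration V) (v : V) : Set Plane :=
  Metric.ball (P.center v) (1 / 2)

/-- The circle bounding the penny at `v`. -/
noncomputable def circle (P : PennyConfiguration V) (v : V) : EuclideanGeometry.Sphere Plane :=
  ⟨P.center v, 1 / 2⟩

/-- Two circles of the configuration are externally tangent iff their centers are at distance
one. -/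
theorem isExtTangent_circle_iff (P : PennyConfiguration V) (v w : V) :
    (P.circle v).IsExtTangent (P.circle w) ↔ dist (P.center v) (P.center w) = 1 := by
  rw [EuclideanGeometry.Sphere.isExtTangent_iff_dist_center]
  norm_num [circle]

/-- The contact graph: two vertices are joined by an edge iff their circles are tangent. -/
def graph (P : PennyConfiguration V) : SimpleGraph V where
  Adj v w := (P.circle v).IsExtTangent (P.circle w)
  symm := ⟨fun v w h => by
    rw [isExtTangent_circle_iff] at h ⊢
    rwa [dist_comm]⟩
  loopless := ⟨fun v h => by
    rw [isExtTangent_circle_iff] at h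
    simp at h⟩

/-- The image in the plane of the vertices and edges of the contact graph: all centers, and all
segments joining the centers of adjacent vertices. -/
def skeleton (P : PennyConfiguration V) : Set Plane :=
  Set.range P.center ∪
    {p | ∃ v w : V, P.graph.Adj v w ∧ p ∈ segment ℝ (P.center v) (P.center w)}

/-- `S` is a connected component of the subset `A` of the plane. -/
def IsComponentOf (S A : Set Plane) : Prop :=
  ∃ p ∈ A, S = connectedComponentIn A p

/-- The faces: the connected components of the complement of the embedded graph. -/
def IsFace (P : PennyConfiguration V) (σ : Set Plane) : Prop :=
  IsComponentOf σ P.skeletonᶜ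

/-- The corners (interior angles) of `σ`. The embedded edges at `v` cut the penny at `v` into open
circular sectors, one for each pair of consecutive edges at `v`; a corner of `σ` at `v` is such a
sector contained in `σ`. A sector of angle `π` counts as a corner, and a vertex at which `σ` has
several sectors contributes each of them. (No edge which is not incident to `v` meets the penny at
`v`, as all distances of centers are at least one.) -/
def corners (P : PennyConfiguration V) (σ : Set Plane) : Set (V × Set Plane) :=
  {c | IsComponentOf c.2 (P.penny c.1 \ P.skeleton) ∧ c.2 ⊆ σ}

/-- The facial degree, in `ℕ ∪ {∞}`: the number of corners. -/
noncomputable def facialDegree (P : PennyConfiguration V) (σ : Set Plane) : ℕ∞ :=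
  (P.corners σ).encard

/-- The combinatorial distance on the vertices of the contact graph. -/
noncomputable def combDist (P : PennyConfiguration V) (x y : V) : ℝ :=
  (P.graph.dist x y : ℝ)

end PennyConfiguration

/-- `ψ` is a quasi-isometry map from `(X, dX)` to `(Y, dY)`. -/
def IsQuasiIsometryMap {X Y : Type*} (dX : X → X → ℝ) (dY : Y → Y → ℝ) (ψ : X → Y) : Prop :=
  ∃ a C : ℝ, 1 ≤ a ∧ 0 < C ∧
    (∀ x₁ x₂ : X, a⁻¹ * dX x₁ x₂ - C ≤ dY (ψ x₁) (ψ x₂) ∧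
      dY (ψ x₁) (ψ x₂) ≤ a * dX x₁ x₂ + C) ∧
    ∀ y : Y, ∃ x : X, dY y (ψ x) < C

open Set Topology

/-!
Call a vertex, an open edge or a face a cell, and let the open star of a vertex be the union of
the cells incident to it. The skeleton is connected, so the complement of a face is connected, and
by unicoherence of the plane so is the frontier of the face. Following this frontier from star to
star shows that the boundary vertices of a face induce a connected subgraph; if there are at most
`n` of them, any two are at combinatorial distance at most `n - 1`.

For the lower bound, walk along the segment between two centers. When it leaves the union of the
stars of the vertices of the current cell of the skeleton, it does so at a point of another cell,
disjoint from the first, and two disjoint closed edges are at distance at least `1 / √2`. Such a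
hop costs at most `n - 1` steps through a face and one step along the new cell, so that the
combinatorial distance is at most `2 n` times the distance.

For the density, a ray from a boundary vertex `u` of the face of `z` through `z` meets the
frontier of the face again, within `1 / 2` of a boundary vertex `w`. The resulting path from
`u` through `z` to `w` has length at most `n`, so one of its ends is within `n / 2` of `z`.
-/

section Connectedness

variable {X : Type*} [TopologicalSpace X]

theorem nonempty_inter_frontier_of_isPreconnected {s t : Set X} (ht : IsPreconnected t)
    (h : (t ∩ s).Nonempty) (h' : (t ∩ sᶜ).Nonempty) : (t ∩ frontier s).Nonempty := by
  by_contra hne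
  have hcover : t ⊆ interior s ∪ interior sᶜ := fun z hz => by
    by_contra hz'
    rw [mem_union, interior_compl, mem_compl_iff, not_or, not_not] at hz'
    exact hne ⟨z, hz, hz'.2, hz'.1⟩
  obtain ⟨x, hxt, hxs⟩ := h
  obtain ⟨y, hyt, hys⟩ := h'
  obtain ⟨z, -, hz, hz'⟩ := ht _ _ isOpen_interior isOpen_interior hcover
    ⟨x, hxt, (hcover hxt).resolve_right fun hx => interior_subset hx hxs⟩
    ⟨y, hyt, (hcover hyt).resolve_left fun hy => hys (interior_subset hy)⟩
  exact interior_subset hz' (interior_subset hz)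

theorem exists_continuousMap_circle_of_union_eq_univ {A B : Set X} (hA : IsClosed A)
    (hB : IsClosed B) (hAB : A ∪ B = univ) {f g : X → Circle} (hf : Continuous f)
    (hg : Continuous g) (hfg : (A ∩ B).EqOn f g) :
    ∃ k : C(X, Circle), A.EqOn k f ∧ B.EqOn k g := by
  classical
  have hpA : A.EqOn (A.piecewise f g) f := piecewise_eqOn A f g
  have hpB : B.EqOn (A.piecewise f g) g := fun z hz => by
    by_cases hzA : z ∈ A
    · rw [hpA hzA, hfg ⟨hzA, hz⟩]
    · exact piecewise_eq_of_notMem A f g hzA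
  refine ⟨⟨A.piecewise f g, ?_⟩, hpA, hpB⟩
  rw [← continuousOn_univ, ← hAB]
  exact (hf.continuousOn.congr hpA).union_of_isClosed (hg.continuousOn.congr hpB) hA hB

theorem eqOn_of_circleExp_eqOn {s : Set X} (hs : IsPreconnected s) {f g : X → ℝ}
    (hf : Continuous f) (hg : Continuous g) (h : s.EqOn (Circle.exp ∘ f) (Circle.exp ∘ g))
    {x : X} (hx : x ∈ s) (hfg : f x = g x) : s.EqOn f g :=
  Circle.isCoveringMap_exp.eqOn_of_comp_eqOn hs hf.continuousOn hg.continuousOn h hx hfg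

theorem isPreconnected_inter_of_union_eq_univ [SimplyConnectedSpace X]
    [LocallyPathConnectedSpace X] [NormalSpace X] {A B : Set X} (hA : IsClosed A)
    (hB : IsClosed B) (hA' : IsPreconnected A) (hB' : IsPreconnected B) (hAB : A ∪ B = univ) :
    IsPreconnected (A ∩ B) := by
  rw [isPreconnected_closed_iff]
  rintro t t' ht ht' hsub ⟨x, hx, hxt⟩ ⟨y, hy, hyt⟩
  by_contra hne
  have hdisj : Disjoint (A ∩ B ∩ t) (A ∩ B ∩ t') :=
    disjoint_left.2 fun z hz hz' => hne ⟨z, hz.1, hz.2, hz'.2⟩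
  obtain ⟨h, h0, h1, -⟩ := exists_continuous_zero_one_of_isClosed
    ((hA.inter hB).inter ht) ((hA.inter hB).inter ht') hdisj
  -- `exp (i π h)` and `exp (-i π h)` agree where `h` is `0` or `1`, hence on `A ∩ B`; a lift of
  -- the glued map equals `π h` on `A` and `-π h` on `B`, which is absurd at `y`.
  have hglue : (A ∩ B).EqOn (fun z => Circle.exp (Real.pi * h z))
      (fun z => Circle.exp (-(Real.pi * h z))) := by
    intro z hz
    rcases hsub hz with hzt | hzt
    · simp [h0 ⟨hz, hzt⟩]
    · exact Circle.exp_eq_exp.2 ⟨1, by rw [h1 ⟨hz, hzt⟩, Pi.one_apply]; push_cast; ring⟩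
  obtain ⟨k, hkA, hkB⟩ := exists_continuousMap_circle_of_union_eq_univ hA hB hAB
    (by fun_prop) (by fun_prop) hglue
  obtain ⟨g, ⟨hgx, hg⟩, -⟩ := Circle.isCoveringMap_exp.existsUnique_continuousMap_lifts k x
    (Real.pi * h x) (hkA hx.1).symm
  have hgA := eqOn_of_circleExp_eqOn (f := g) (g := fun z => Real.pi * h z) hA' g.continuous
    (by fun_prop) (fun z hz => (congrFun hg z).trans (hkA hz)) hx.1 hgx
  have hgB := eqOn_of_circleExp_eqOn (f := g) (g := fun z => -(Real.pi * h z)) hB' g.continuous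
    (by fun_prop) (fun z hz => (congrFun hg z).trans (hkB hz)) hx.2
    (by simp [hgx, h0 ⟨hx, hxt⟩])
  have hpi : Real.pi * h y = -(Real.pi * h y) := (hgA hy.1).symm.trans (hgB hy.2)
  rw [h1 ⟨hy, hyt⟩, Pi.one_apply] at hpi
  linarith [Real.pi_pos]

variable {S : Set X} {x : X}

theorem frontier_connectedComponentIn_compl_subset [LocallyConnectedSpace X] (hS : IsClosed S) :
    frontier (connectedComponentIn Sᶜ x) ⊆ S := by
  intro z hz
  by_contra hzS
  have hopen : ∀ y, IsOpen (connectedComponentIn Sᶜ y) := fun y =>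
    hS.isOpen_compl.connectedComponentIn
  obtain ⟨y, hyz, hyx⟩ := mem_closure_iff.1 hz.1 _ (hopen z) (mem_connectedComponentIn hzS)
  refine hz.2 (mem_interior_iff_mem_nhds.2 ?_)
  rw [connectedComponentIn_eq hyx, ← connectedComponentIn_eq hyz]
  exact (hopen z).mem_nhds (mem_connectedComponentIn hzS)

theorem isPreconnected_compl_connectedComponentIn_compl [LocallyConnectedSpace X]
    [PreconnectedSpace X] (hS : IsClosed S) (hS' : IsConnected S) :
    IsPreconnected (connectedComponentIn Sᶜ x)ᶜ := by
  have hsub : S ⊆ (connectedComponentIn Sᶜ x)ᶜ :=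
    subset_compl_comm.1 (connectedComponentIn_subset _ _)
  obtain ⟨p, hp⟩ := hS'.nonempty
  refine isPreconnected_of_forall p fun z hz => ?_
  by_cases hzS : z ∈ S
  · exact ⟨S, hsub, hp, hzS, hS'.isPreconnected⟩
  set C := connectedComponentIn Sᶜ z
  have hzC : z ∈ C := mem_connectedComponentIn hzS
  have hCS : C ⊆ Sᶜ := connectedComponentIn_subset _ _
  have hCσ : C ⊆ (connectedComponentIn Sᶜ x)ᶜ := fun y hy hyx => hz <| by
    rwa [connectedComponentIn_eq hyx, ← connectedComponentIn_eq hy]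
  obtain ⟨q, -, hq⟩ := nonempty_inter_frontier_of_isPreconnected isPreconnected_univ
    ⟨z, trivial, hzC⟩ ⟨p, trivial, fun hpC => hCS hpC hp⟩
  have hqS : q ∈ S := frontier_connectedComponentIn_compl_subset hS hq
  refine ⟨insert q C ∪ S, union_subset (insert_subset (hsub hqS) hCσ) hsub, .inr hp,
    .inl (mem_insert_of_mem _ hzC), .union q (mem_insert _ _) hqS ?_ hS'.isPreconnected⟩
  exact isPreconnected_connectedComponentIn.subset_closure (subset_insert _ _)
    (insert_subset hq.1 subset_closure)

theorem isPreconnected_frontier_connectedComponentIn_compl [SimplyConnectedSpace X]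
    [LocallyPathConnectedSpace X] [NormalSpace X] (hS : IsClosed S) (hS' : IsConnected S) :
    IsPreconnected (frontier (connectedComponentIn Sᶜ x)) := by
  have hopen : IsOpen (connectedComponentIn Sᶜ x) := hS.isOpen_compl.connectedComponentIn
  rw [frontier, hopen.interior_eq, sdiff_eq]
  exact isPreconnected_inter_of_union_eq_univ isClosed_closure hopen.isClosed_compl
    isPreconnected_connectedComponentIn.closure
    (isPreconnected_compl_connectedComponentIn_compl hS hS')
    (eq_univ_of_subset (union_subset_union_left _ subset_closure) (union_compl_self _))

end Connectedness

section NormedSpace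

variable {E : Type*} [NormedAddCommGroup E] [NormedSpace ℝ E]

theorem isPreconnected_compl_closedBall_zero (hE : 1 < Module.rank ℝ E) {r : ℝ} (hr : 0 ≤ r) :
    IsPreconnected (Metric.closedBall (0 : E) r)ᶜ := by
  have hprod : IsPreconnected (Ioi r ×ˢ Metric.sphere (0 : E) 1) :=
    isPreconnected_Ioi.prod (isPreconnected_sphere hE 0 1)
  convert hprod.image (fun p : ℝ × E => p.1 • p.2) (Continuous.continuousOn (by fun_prop)) using 1
  ext z
  simp only [mem_compl_iff, Metric.mem_closedBall, dist_zero_right, not_le, mem_image, mem_prod,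
    mem_Ioi, mem_sphere_zero_iff_norm, Prod.exists]
  constructor
  · intro hz
    have hz0 : ‖z‖ ≠ 0 := (hr.trans_lt hz).ne'
    refine ⟨‖z‖, ‖z‖⁻¹ • z, ⟨hz, ?_⟩, ?_⟩
    · rw [norm_smul, norm_inv, norm_norm, inv_mul_cancel₀ hz0]
    · rw [smul_smul, mul_inv_cancel₀ hz0, one_smul]
  · rintro ⟨a, b, ⟨ha, hb⟩, rfl⟩
    rw [norm_smul, hb, mul_one, Real.norm_eq_abs]
    exact ha.trans_le (le_abs_self a)

theorem isBounded_or_isBounded_compl_of_frontier (hE : 1 < Module.rank ℝ E) {s : Set E}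
    (hs : Bornology.IsBounded (frontier s)) :
    Bornology.IsBounded s ∨ Bornology.IsBounded sᶜ := by
  obtain ⟨r, hr, hball⟩ := hs.subset_closedBall_lt 0 0
  by_contra! hcon
  have hmeets : ∀ t : Set E, ¬ Bornology.IsBounded t →
      ((Metric.closedBall (0 : E) r)ᶜ ∩ t).Nonempty := fun t ht => by
    obtain ⟨z, hzt, hz⟩ := not_subset.1 fun h => ht (Metric.isBounded_closedBall.subset h)
    exact ⟨z, hz, hzt⟩
  obtain ⟨q, hq, hqs⟩ := nonempty_inter_frontier_of_isPreconnected
    (isPreconnected_compl_closedBall_zero hE hr.le) (hmeets s hcon.1) (hmeets sᶜ hcon.2)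
  exact hq (hball hqs)

theorem exists_wbtw_mem_frontier_of_isBounded {s : Set E} (hs : Bornology.IsBounded s)
    {u z : E} (huz : u ≠ z) (hz : z ∈ s) : ∃ q ∈ frontier s, Wbtw ℝ u z q := by
  obtain ⟨r, hr⟩ := hs.subset_closedBall u
  have hd : 0 < dist u z := dist_pos.2 huz
  set t : ℝ := max 1 ((r + 1) / dist u z)
  have hfar : AffineMap.lineMap u z t ∉ s := fun hmem => by
    have hle := hr hmem
    rw [Metric.mem_closedBall, dist_lineMap_left, Real.norm_of_nonneg (by positivity)] at hle
    have : (r + 1) / dist u z * dist u z ≤ t * dist u z := by gcongr; exact le_max_right _ _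
    rw [div_mul_cancel₀ _ hd.ne'] at this
    linarith
  have hray : IsPreconnected (AffineMap.lineMap (k := ℝ) u z '' Icc 1 t) :=
    isPreconnected_Icc.image _ (AffineMap.lineMap_continuous).continuousOn
  obtain ⟨-, ⟨b, hb, rfl⟩, hq⟩ := nonempty_inter_frontier_of_isPreconnected hray
    ⟨z, ⟨1, left_mem_Icc.2 (le_max_left _ _), AffineMap.lineMap_apply_one _ _⟩, hz⟩
    ⟨_, ⟨t, right_mem_Icc.2 (le_max_left _ _), rfl⟩, hfar⟩
  refine ⟨_, hq, ?_⟩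
  have hb0 : b ≠ 0 := by linarith [hb.1]
  refine ⟨b⁻¹, ⟨inv_nonneg.2 (zero_le_one.trans hb.1), inv_le_one_of_one_le₀ hb.1⟩, ?_⟩
  simp [AffineMap.lineMap_apply, smul_smul, hb0]

end NormedSpace

section InnerProductSpace

variable {E : Type*} [NormedAddCommGroup E] [InnerProductSpace ℝ E]

theorem dist_lineMap_lineMap_sq (u v w x : E) (s t : ℝ) :
    dist (AffineMap.lineMap u v s) (AffineMap.lineMap w x t) ^ 2 =
      (1 - s) * (1 - t) * dist u w ^ 2 + (1 - s) * t * dist u x ^ 2 +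
        s * (1 - t) * dist v w ^ 2 + s * t * dist v x ^ 2 -
        s * (1 - s) * dist u v ^ 2 - t * (1 - t) * dist w x ^ 2 := by
  simp only [AffineMap.lineMap_apply_module, dist_eq_norm, ← real_inner_self_eq_norm_sq,
    inner_sub_left, inner_sub_right, inner_add_left, inner_add_right, inner_smul_left,
    inner_smul_right, real_inner_comm u, real_inner_comm v w, real_inner_comm v x,
    real_inner_comm w x, RCLike.conj_to_real]
  ring

theorem half_le_dist_sq_of_mem_segment {u v w x p q : E} (huv : dist u v ≤ 1)
    (hwx : dist w x ≤ 1) (huw : 1 ≤ dist u w) (hux : 1 ≤ dist u x) (hvw : 1 ≤ dist v w)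
    (hvx : 1 ≤ dist v x) (hp : p ∈ segment ℝ u v) (hq : q ∈ segment ℝ w x) :
    1 / 2 ≤ dist p q ^ 2 := by
  rw [segment_eq_image_lineMap] at hp hq
  obtain ⟨s, ⟨hs0, hs1⟩, rfl⟩ := hp
  obtain ⟨t, ⟨ht0, ht1⟩, rfl⟩ := hq
  rw [dist_lineMap_lineMap_sq]
  have : 0 ≤ 1 - s := sub_nonneg.2 hs1
  have : 0 ≤ 1 - t := sub_nonneg.2 ht1
  calc (1 / 2 : ℝ) ≤ (1 - s) * (1 - t) * 1 ^ 2 + (1 - s) * t * 1 ^ 2 + s * (1 - t) * 1 ^ 2 +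
        s * t * 1 ^ 2 - s * (1 - s) * 1 ^ 2 - t * (1 - t) * 1 ^ 2 := by
        nlinarith [sq_nonneg (s - 1 / 2), sq_nonneg (t - 1 / 2)]
    _ ≤ _ := by gcongr

end InnerProductSpace

section Module

variable {E : Type*} [AddCommGroup E] [Module ℝ E] {a b c p : E}

theorem mem_openSegment_iff_homothety :
    p ∈ openSegment ℝ a b ↔ ∃ t ∈ Ioo (0 : ℝ) 1, AffineMap.homothety a t b = p := by
  rw [openSegment_eq_image_lineMap]
  rfl

theorem openSegment_subset_openSegment_left (h : b ∈ openSegment ℝ a c) :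
    openSegment ℝ a b ⊆ openSegment ℝ a c := by
  intro p hp
  rw [mem_openSegment_iff_homothety] at h hp ⊢
  obtain ⟨s, hs, rfl⟩ := h
  obtain ⟨t, ht, rfl⟩ := hp
  exact ⟨t * s, ⟨mul_pos ht.1 hs.1, mul_lt_one_of_nonneg_of_lt_one_left ht.1.le ht.2 hs.2.le⟩,
    AffineMap.homothety_mul_apply _ _ _ _⟩

theorem exists_pos_homothety_eq_of_mem_openSegment (hb : p ∈ openSegment ℝ a b)
    (hc : p ∈ openSegment ℝ a c) : ∃ r : ℝ, 0 < r ∧ AffineMap.homothety a r b = c := by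
  rw [mem_openSegment_iff_homothety] at hb hc
  obtain ⟨s, hs, hsp⟩ := hb
  obtain ⟨t, ht, htp⟩ := hc
  refine ⟨t⁻¹ * s, mul_pos (inv_pos.2 ht.1) hs.1, ?_⟩
  rw [AffineMap.homothety_mul_apply, hsp, ← htp, ← AffineMap.homothety_mul_apply,
    inv_mul_cancel₀ ht.1.ne', AffineMap.homothety_one, AffineMap.id_apply]

end Module

section NormedSpace

variable {E : Type*} [NormedAddCommGroup E] [NormedSpace ℝ E] {a b c p : E}

theorem eq_of_mem_openSegment_of_dist_eq (h : dist a b = dist a c)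
    (hb : p ∈ openSegment ℝ a b) (hc : p ∈ openSegment ℝ a c) : b = c := by
  obtain ⟨r, hr, rfl⟩ := exists_pos_homothety_eq_of_mem_openSegment hb hc
  rw [dist_center_homothety, Real.norm_of_nonneg hr.le, eq_comm, mul_left_eq_self₀] at h
  rcases h with rfl | h
  · rw [AffineMap.homothety_one, AffineMap.id_apply]
  · rw [dist_eq_zero.1 h, AffineMap.homothety_apply_same]

theorem mem_openSegment_of_dist_lt (h : dist a c < dist a b)
    (hb : p ∈ openSegment ℝ a b) (hc : p ∈ openSegment ℝ a c) : c ∈ openSegment ℝ a b := by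
  have hpos : 0 < dist a b := dist_nonneg.trans_lt h
  obtain ⟨r, hr, rfl⟩ := exists_pos_homothety_eq_of_mem_openSegment hb hc
  rw [dist_center_homothety, Real.norm_of_nonneg hr.le, mul_lt_iff_lt_one_left hpos] at h
  exact mem_openSegment_iff_homothety.2 ⟨r, ⟨hr, h⟩, rfl⟩

end NormedSpace

namespace PennyConfiguration

variable {V : Type*} (P : PennyConfiguration V)

theorem adj_iff {v w : V} : P.graph.Adj v w ↔ dist (P.center v) (P.center w) = 1 :=
  P.isExtTangent_circle_iff v w

theorem one_le_dist {v w : V} (h : v ≠ w) : 1 ≤ dist (P.center v) (P.center w) := by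
  have := (disjoint_ball_ball_iff (by norm_num) (by norm_num)).1 (P.disjoint_pennies v w h)
  linarith

theorem eq_of_dist_lt_one {v w : V} (h : dist (P.center v) (P.center w) < 1) : v = w := by
  by_contra hne
  exact h.not_ge (P.one_le_dist hne)

theorem dist_le_one_iff {v w : V} :
    dist (P.center v) (P.center w) ≤ 1 ↔ v = w ∨ P.graph.Adj v w := by
  rw [P.adj_iff]
  constructor
  · exact fun h => h.lt_or_eq.imp_left P.eq_of_dist_lt_one
  · rintro (rfl | h)
    · simp
    · exact h.le

theorem finite_setOf_dist_le (z : Plane) (r : ℝ) : {v : V | dist (P.center v) z ≤ r}.Finite := by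
  let _ : TopologicalSpace V := ⊥
  have : DiscreteTopology V := ⟨rfl⟩
  have hemb := Metric.isClosedEmbedding_of_pairwise_le_dist zero_lt_one (f := P.center)
    fun v w h => P.one_le_dist h
  exact (hemb.isCompact_preimage (isCompact_closedBall z r)).finite_of_discrete

theorem two_thirds_le_dist_of_mem_segment {u v w x : V} {p q : Plane} (huw : u ≠ w)
    (hux : u ≠ x) (hvw : v ≠ w) (hvx : v ≠ x) (huv : dist (P.center u) (P.center v) ≤ 1)
    (hwx : dist (P.center w) (P.center x) ≤ 1) (hp : p ∈ segment ℝ (P.center u) (P.center v))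
    (hq : q ∈ segment ℝ (P.center w) (P.center x)) : 2 / 3 ≤ dist p q := by
  have := half_le_dist_sq_of_mem_segment huv hwx (P.one_le_dist huw) (P.one_le_dist hux)
    (P.one_le_dist hvw) (P.one_le_dist hvx) hp hq
  exact le_of_sq_le_sq (by linarith) dist_nonneg

theorem mem_skeleton_iff {z : Plane} : z ∈ P.skeleton ↔ ∃ v w,
    dist (P.center v) (P.center w) ≤ 1 ∧ z ∈ segment ℝ (P.center v) (P.center w) := by
  constructor
  · rintro (⟨v, rfl⟩ | ⟨v, w, hvw, hz⟩)
    · exact ⟨v, v, by simp, left_mem_segment _ _ _⟩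
    · exact ⟨v, w, (P.adj_iff.1 hvw).le, hz⟩
  · rintro ⟨v, w, hvw, hz⟩
    rcases P.dist_le_one_iff.1 hvw with rfl | hadj
    · rw [segment_same] at hz
      exact .inl ⟨v, hz.symm⟩
    · exact .inr ⟨v, w, hadj, hz⟩

theorem center_mem_skeleton (v : V) : P.center v ∈ P.skeleton := .inl ⟨v, rfl⟩

theorem skeleton_eq_iUnion :
    P.skeleton = ⋃ e : {e : V × V // dist (P.center e.1) (P.center e.2) ≤ 1},
      segment ℝ (P.center e.1.1) (P.center e.1.2) := by
  ext z
  simp [P.mem_skeleton_iff]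

theorem isClosed_skeleton : IsClosed P.skeleton := by
  rw [skeleton_eq_iUnion]
  refine LocallyFinite.isClosed_iUnion (fun z => ?_) fun e => ?_
  · refine ⟨Metric.ball z 1, Metric.ball_mem_nhds z one_pos, Set.Finite.subset
      (((P.finite_setOf_dist_le z 2).prod (P.finite_setOf_dist_le z 2)).preimage
        Subtype.val_injective.injOn) ?_⟩
    rintro ⟨⟨v, w⟩, (hvw : dist (P.center v) (P.center w) ≤ 1)⟩
      ⟨p, (hp : p ∈ segment ℝ (P.center v) (P.center w)), hpz⟩
    have hsum := dist_add_dist_of_mem_segment hp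
    rw [Metric.mem_ball] at hpz
    have hv : dist (P.center v) z ≤ 2 := by
      linarith [dist_triangle (P.center v) p z, dist_nonneg (x := p) (y := P.center w)]
    have hw : dist (P.center w) z ≤ 2 := by
      linarith [dist_triangle_left (P.center w) z p, dist_nonneg (x := P.center v) (y := p)]
    exact ⟨hv, hw⟩
  · rw [segment_eq_image_lineMap]
    exact (isCompact_Icc.image AffineMap.lineMap_continuous).isClosed

theorem countable_vertices (P : PennyConfiguration V) : Countable V :=
  Pairwise.countable_of_isOpen_disjoint (fun v w h => P.disjoint_pennies v w h)
    (fun _ => Metric.isOpen_ball) fun _ => Metric.nonempty_ball.2 (by norm_num)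

theorem interior_skeleton : interior P.skeleton = ∅ := by
  have := P.countable_vertices
  refine MeasureTheory.Measure.interior_eq_empty_of_null (μ := MeasureTheory.volume) ?_
  rw [skeleton_eq_iUnion, MeasureTheory.measure_iUnion_null_iff]
  intro e
  refine MeasureTheory.measure_mono_null (fun z hz => (mem_segment_iff_wbtw.1 hz).mem_affineSpan)
    (MeasureTheory.Measure.addHaar_affineSubspace _ _ fun htop => ?_)
  have hrank := (collinear_pair ℝ (P.center e.1.1) (P.center e.1.2)).finrank_le_one
  rw [← direction_affineSpan, htop, AffineSubspace.direction_top, finrank_top,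
    finrank_euclideanSpace_fin] at hrank
  norm_num at hrank

/-- The point `z` lies in a relatively open cell of the skeleton incident to the vertex `u`: it is
the center of `u` (the degenerate case `w = u`) or an interior point of an edge at `u`. -/
def OnOpenEdge (u : V) (z : Plane) : Prop :=
  ∃ w, dist (P.center u) (P.center w) ≤ 1 ∧ z ∈ openSegment ℝ (P.center u) (P.center w)

theorem onOpenEdge_center (u : V) : P.OnOpenEdge u (P.center u) :=
  ⟨u, by simp, by simp⟩

theorem onOpenEdge_of_mem_segment {v w : V} {z : Plane}
    (hvw : dist (P.center v) (P.center w) ≤ 1)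
    (hz : z ∈ segment ℝ (P.center v) (P.center w)) (hzw : z ≠ P.center w) :
    P.OnOpenEdge v z := by
  rcases eq_or_ne z (P.center v) with rfl | hzv
  · exact P.onOpenEdge_center v
  · exact ⟨w, hvw, mem_openSegment_of_ne_left_right hzv.symm hzw.symm hz⟩

theorem exists_onOpenEdge {z : Plane} (hz : z ∈ P.skeleton) :
    ∃ u, P.OnOpenEdge u z ∧ dist z (P.center u) ≤ 1 / 2 := by
  obtain ⟨v, w, hvw, hz⟩ := P.mem_skeleton_iff.1 hz
  rcases eq_or_ne z (P.center w) with rfl | hzw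
  · exact ⟨w, P.onOpenEdge_center w, by simp⟩
  rcases eq_or_ne z (P.center v) with rfl | hzv
  · exact ⟨v, P.onOpenEdge_center v, by simp⟩
  have hsum := dist_add_dist_of_mem_segment hz
  rw [dist_comm _ z] at hsum
  rcases le_total (dist z (P.center v)) (1 / 2) with hle | hge
  · exact ⟨v, P.onOpenEdge_of_mem_segment hvw hz hzw, hle⟩
  · exact ⟨w, P.onOpenEdge_of_mem_segment (by rwa [dist_comm]) (by rwa [segment_symm]) hzv,
      by linarith⟩

theorem onOpenEdge_of_dist_lt {u : V} {z : Plane} (hz : z ∈ P.skeleton)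
    (hd : dist z (P.center u) < 2 / 3) : P.OnOpenEdge u z := by
  obtain ⟨v, w, hvw, hz⟩ := P.mem_skeleton_iff.1 hz
  have hedge : ∀ {x}, dist (P.center u) (P.center x) ≤ 1 →
      z ∈ segment ℝ (P.center u) (P.center x) → P.OnOpenEdge u z := fun {x} hux hz => by
    rcases eq_or_ne z (P.center x) with rfl | hne
    · rw [P.eq_of_dist_lt_one (hd.trans (by norm_num))]
      exact P.onOpenEdge_center u
    · exact P.onOpenEdge_of_mem_segment hux hz hne
  rcases eq_or_ne v u with rfl | hvu
  · exact hedge hvw hz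
  rcases eq_or_ne w u with rfl | hwu
  · exact hedge (by rwa [dist_comm]) (by rwa [segment_symm])
  exact absurd (P.two_thirds_le_dist_of_mem_segment hvu hvu hwu hwu hvw (by simp) hz
    (right_mem_segment _ _ _)) hd.not_ge

theorem eq_of_mem_openSegment {a u w : V} {z : Plane} (hau : dist (P.center a) (P.center u) ≤ 1)
    (haw : dist (P.center a) (P.center w) ≤ 1)
    (hu : z ∈ openSegment ℝ (P.center a) (P.center u))
    (hw : z ∈ openSegment ℝ (P.center a) (P.center w)) : u = w := by
  have hdegenerate : ∀ {x}, P.center a ∈ openSegment ℝ (P.center a) (P.center x) → a = x :=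
    fun h => P.eq_of_dist_lt_one (by rw [left_mem_openSegment_iff.1 h, dist_self]; exact one_pos)
  rcases P.dist_le_one_iff.1 hau with rfl | hau
  · rw [openSegment_same, mem_singleton_iff] at hu
    exact hdegenerate (hu ▸ hw)
  rcases P.dist_le_one_iff.1 haw with rfl | haw
  · rw [openSegment_same, mem_singleton_iff] at hw
    exact (hdegenerate (hw ▸ hu)).symm
  have := eq_of_mem_openSegment_of_dist_eq
    ((P.adj_iff.1 hau).trans (P.adj_iff.1 haw).symm) hu hw
  exact P.eq_of_dist_lt_one (by rw [this, dist_self]; exact one_pos)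

theorem eq_or_eq_of_mem_openSegment {u v w x : V} {z : Plane}
    (huv : dist (P.center u) (P.center v) ≤ 1) (hwx : dist (P.center w) (P.center x) ≤ 1)
    (hz : z ∈ openSegment ℝ (P.center u) (P.center v))
    (hz' : z ∈ openSegment ℝ (P.center w) (P.center x)) : u = w ∨ u = x := by
  by_contra! hne
  have hvu : dist (P.center v) (P.center u) ≤ 1 := by rwa [dist_comm]
  have hzvu : z ∈ openSegment ℝ (P.center v) (P.center u) := by rwa [openSegment_symm]
  rcases eq_or_ne v w with rfl | hvw
  · exact hne.2 (P.eq_of_mem_openSegment hvu hwx hzvu hz')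
  rcases eq_or_ne v x with rfl | hvx
  · exact hne.1 (P.eq_of_mem_openSegment hvu (by rwa [dist_comm]) hzvu
      (by rwa [openSegment_symm]))
  have := P.two_thirds_le_dist_of_mem_segment hne.1 hne.2 hvw hvx huv hwx
    (openSegment_subset_segment _ _ _ hz) (openSegment_subset_segment _ _ _ hz')
  norm_num at this

variable {P}

theorem OnOpenEdge.mem_skeleton {u : V} {z : Plane} : P.OnOpenEdge u z → z ∈ P.skeleton :=
  fun ⟨w, huw, hz⟩ => P.mem_skeleton_iff.2 ⟨u, w, huw, openSegment_subset_segment _ _ _ hz⟩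

theorem OnOpenEdge.eq_of_center {u v : V} : P.OnOpenEdge v (P.center u) → v = u := by
  rintro ⟨w, hvw, hu⟩
  exact or_self_iff.1 (P.eq_or_eq_of_mem_openSegment hvw (by simp) hu
    (by simp : P.center u ∈ openSegment ℝ (P.center u) (P.center u)))

theorem OnOpenEdge.dist_le_one {u v : V} {z : Plane} (hu : P.OnOpenEdge u z)
    (hv : P.OnOpenEdge v z) : dist (P.center u) (P.center v) ≤ 1 := by
  obtain ⟨x, hux, hzx⟩ := hu
  obtain ⟨y, hvy, hzy⟩ := hv
  rcases P.eq_or_eq_of_mem_openSegment hux hvy hzx hzy with rfl | rfl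
  · simp
  · rwa [dist_comm]

theorem OnOpenEdge.two_thirds_le_dist {u w : V} {p q : Plane} (hu : P.OnOpenEdge u p)
    (hw : P.OnOpenEdge w q) (h : ∀ v, P.OnOpenEdge v p → ¬ P.OnOpenEdge v q) :
    2 / 3 ≤ dist p q := by
  have hends : ∀ {a b : V} {z : Plane}, dist (P.center a) (P.center b) ≤ 1 →
      z ∈ openSegment ℝ (P.center a) (P.center b) → P.OnOpenEdge a z ∧ P.OnOpenEdge b z :=
    fun {a b z} hab hz => ⟨⟨b, hab, hz⟩, a, by rwa [dist_comm], by rwa [openSegment_symm]⟩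
  obtain ⟨v, huv, hp⟩ := hu
  obtain ⟨x, hwx, hq⟩ := hw
  obtain ⟨hup, hvp⟩ := hends huv hp
  obtain ⟨hwq, hxq⟩ := hends hwx hq
  have hne : ∀ {a b}, P.OnOpenEdge a p → P.OnOpenEdge b q → a ≠ b := fun {a b} ha hb hab =>
    h a ha (hab ▸ hb)
  exact P.two_thirds_le_dist_of_mem_segment (hne hup hwq) (hne hup hxq) (hne hvp hwq)
    (hne hvp hxq) huv hwx (openSegment_subset_segment _ _ _ hp)
    (openSegment_subset_segment _ _ _ hq)

end PennyConfiguration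

namespace PennyConfiguration

variable {V : Type*} (P : PennyConfiguration V)

theorem exists_isFace_mem {z : Plane} (hz : z ∉ P.skeleton) : ∃ σ, P.IsFace σ ∧ z ∈ σ :=
  ⟨_, ⟨z, hz, rfl⟩, mem_connectedComponentIn hz⟩

/-- The vertices on the boundary of a face `σ`. -/
def boundaryVertices (σ : Set Plane) : Set V := {u | P.center u ∈ closure σ}

/-- The open star of the vertex `u`: the union of the vertex, the open edges and the faces incident
to it. -/
def star (u : V) : Set Plane :=
  {z | P.OnOpenEdge u z ∨ ∃ σ, P.IsFace σ ∧ z ∈ σ ∧ u ∈ P.boundaryVertices σ}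

variable {P} {σ : Set Plane} {u w : V} {z : Plane}

theorem IsFace.isOpen (hσ : P.IsFace σ) : IsOpen σ := by
  obtain ⟨z, -, rfl⟩ := hσ
  exact P.isClosed_skeleton.isOpen_compl.connectedComponentIn

theorem IsFace.subset_compl_skeleton (hσ : P.IsFace σ) : σ ⊆ P.skeletonᶜ := by
  obtain ⟨z, -, rfl⟩ := hσ
  exact connectedComponentIn_subset _ _

theorem IsFace.subset_of_isPreconnected (hσ : P.IsFace σ) {t : Set Plane}
    (ht : IsPreconnected t) (htS : t ⊆ P.skeletonᶜ) (hz : z ∈ σ) (hzt : z ∈ t) : t ⊆ σ := by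
  obtain ⟨x, -, rfl⟩ := hσ
  rw [connectedComponentIn_eq hz]
  exact ht.subset_connectedComponentIn hzt htS

theorem IsFace.eq_of_mem {τ : Set Plane} (hσ : P.IsFace σ) (hτ : P.IsFace τ) (hzσ : z ∈ σ)
    (hzτ : z ∈ τ) : σ = τ := by
  obtain ⟨x, -, rfl⟩ := hσ
  obtain ⟨y, -, rfl⟩ := hτ
  rw [connectedComponentIn_eq hzσ, connectedComponentIn_eq hzτ]

theorem IsFace.mem_boundaryVertices_of_mem_star (hσ : P.IsFace σ) (hzσ : z ∈ σ)
    (hz : z ∈ P.star u) : u ∈ P.boundaryVertices σ := by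
  rcases hz with hz | ⟨τ, hτ, hzτ, hu⟩
  · exact absurd hz.mem_skeleton (hσ.subset_compl_skeleton hzσ)
  · rwa [hσ.eq_of_mem hτ hzσ hzτ]

theorem onOpenEdge_of_mem_star (hz : z ∈ P.star u) (hzS : z ∈ P.skeleton) : P.OnOpenEdge u z :=
  hz.resolve_right fun ⟨_, hσ, hzσ, _⟩ => hσ.subset_compl_skeleton hzσ hzS

theorem OnOpenEdge.of_mem_openSegment {p : Plane} (hw : P.OnOpenEdge w z)
    (hu : P.OnOpenEdge u z) (hp : p ∈ openSegment ℝ (P.center w) z) : P.OnOpenEdge u p := by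
  obtain ⟨x, hwx, hzx⟩ := hw
  obtain ⟨y, huy, hzy⟩ := hu
  have hpx := openSegment_subset_openSegment_left hzx hp
  rcases P.eq_or_eq_of_mem_openSegment huy hwx hzy hzx with rfl | rfl
  · exact ⟨x, hwx, hpx⟩
  · exact ⟨w, by rwa [dist_comm], by rwa [openSegment_symm]⟩

theorem disjoint_openSegment_skeleton (hzS : z ∉ P.skeleton)
    (hd : dist z (P.center w) < 2 / 3) :
    Disjoint (openSegment ℝ (P.center w) z) P.skeleton := by
  rw [disjoint_left]
  intro p hp hpS
  have hpw : dist p (P.center w) < 2 / 3 := by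
    have := dist_add_dist_of_mem_segment (openSegment_subset_segment _ _ _ hp)
    linarith [dist_nonneg (x := p) (y := z), dist_comm p (P.center w), dist_comm z (P.center w)]
  obtain ⟨x, hwx, hpx⟩ := P.onOpenEdge_of_dist_lt hpS hpw
  rcases P.dist_le_one_iff.1 hwx with rfl | hadj
  · rw [openSegment_same, mem_singleton_iff] at hpx
    rw [hpx, left_mem_openSegment_iff] at hp
    exact hzS (hp ▸ P.center_mem_skeleton w)
  · have hz : z ∈ openSegment ℝ (P.center w) (P.center x) := by
      refine mem_openSegment_of_dist_lt ?_ hpx hp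
      rw [P.adj_iff.1 hadj, dist_comm]
      linarith
    exact hzS (OnOpenEdge.mem_skeleton ⟨x, hwx, hz⟩)

theorem IsFace.openSegment_subset (hσ : P.IsFace σ) (hz : z ∈ σ)
    (hd : dist z (P.center w) < 2 / 3) : openSegment ℝ (P.center w) z ⊆ σ := by
  have hzS := hσ.subset_compl_skeleton hz
  have hpre : IsPreconnected (insert z (openSegment ℝ (P.center w) z)) :=
    (convex_openSegment _ _).isPreconnected.subset_closure (subset_insert _ _)
      (insert_subset (by rw [closure_openSegment]; exact right_mem_segment _ _ _)
        subset_closure)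
  refine (subset_insert _ _).trans (hσ.subset_of_isPreconnected hpre ?_ hz (mem_insert _ _))
  exact insert_subset hzS (disjoint_openSegment_skeleton hzS hd).subset_compl_right

theorem ball_subset_star : Metric.ball (P.center u) (2 / 3) ⊆ P.star u := by
  intro z hz
  by_cases hzS : z ∈ P.skeleton
  · exact .inl (P.onOpenEdge_of_dist_lt hzS hz)
  obtain ⟨σ, hσ, hzσ⟩ := P.exists_isFace_mem hzS
  refine .inr ⟨σ, hσ, hzσ, closure_mono (hσ.openSegment_subset hzσ hz) ?_⟩
  rw [closure_openSegment]
  exact left_mem_segment _ _ _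

theorem openSegment_subset_star (hz : z ∈ P.star u) (hd : dist z (P.center w) < 2 / 3) :
    openSegment ℝ (P.center w) z ⊆ P.star u := by
  intro p hp
  rcases hz with hz | ⟨σ, hσ, hzσ, hu⟩
  · exact .inl ((P.onOpenEdge_of_dist_lt hz.mem_skeleton hd).of_mem_openSegment hz hp)
  · exact .inr ⟨σ, hσ, hσ.openSegment_subset hzσ hd hp, hu⟩

theorem homothety_image_subset_star {t : ℝ} (ht : t ∈ Ioo 0 1) :
    AffineMap.homothety (P.center w) t ''
      (Metric.ball (P.center u) (2 / 3) ∩ Metric.ball (P.center w) (2 / 3)) ⊆ P.star u := by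
  rintro _ ⟨z, ⟨hzu, hzw⟩, rfl⟩
  exact openSegment_subset_star (ball_subset_star hzu) hzw
    (mem_openSegment_iff_homothety.2 ⟨t, ht, rfl⟩)

theorem isOpen_star : IsOpen (P.star u) := by
  refine isOpen_iff_mem_nhds.2 fun z hz => ?_
  rcases hz with ⟨w, huw, hz⟩ | ⟨σ, hσ, hzσ, hu⟩
  swap
  · exact Filter.mem_of_superset (hσ.isOpen.mem_nhds hzσ) fun y hy => .inr ⟨σ, hσ, hy, hu⟩
  rw [openSegment_symm, mem_openSegment_iff_homothety] at hz
  obtain ⟨s, hs, rfl⟩ := hz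
  rw [dist_comm] at huw
  rcases le_or_gt (1 / 2) s with hle | hlt
  · refine Filter.mem_of_superset (Metric.isOpen_ball.mem_nhds ?_) ball_subset_star
    rw [Metric.mem_ball, dist_homothety_self, Real.norm_of_nonneg (by linarith [hs.2])]
    nlinarith [hs.2]
  -- The homothety at `w` of ratio `2 s` maps the midpoint of the edge, which is close to both
  -- ends, to the given point.
  set m := AffineMap.homothety (P.center w) (1 / 2 : ℝ) (P.center u)
  have hmu : m ∈ Metric.ball (P.center u) (2 / 3) := by
    rw [Metric.mem_ball, dist_homothety_self, Real.norm_of_nonneg (by norm_num)]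
    linarith
  have hmw : m ∈ Metric.ball (P.center w) (2 / 3) := by
    rw [Metric.mem_ball, dist_homothety_center, Real.norm_of_nonneg (by norm_num)]
    linarith
  have hm : AffineMap.homothety (P.center w) (2 * s) m =
      AffineMap.homothety (P.center w) s (P.center u) := by
    rw [← AffineMap.homothety_mul_apply]
    congr 2
    ring
  have hopen := (AffineMap.homothety_isOpenMap (P.center w) (2 * s) (by linarith [hs.1])) _
    ((Metric.isOpen_ball (x := P.center u) (ε := 2 / 3)).inter
      (Metric.isOpen_ball (x := P.center w) (ε := 2 / 3)))
  exact Filter.mem_of_superset (hopen.mem_nhds ⟨m, ⟨hmu, hmw⟩, hm⟩)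
    (homothety_image_subset_star ⟨by linarith [hs.1], by linarith⟩)

theorem IsFace.mem_boundaryVertices_of_mem_closure (hσ : P.IsFace σ) (hz : z ∈ closure σ)
    (hzu : z ∈ P.star u) : u ∈ P.boundaryVertices σ := by
  obtain ⟨y, hyu, hyσ⟩ := mem_closure_iff.1 hz _ isOpen_star hzu
  exact hσ.mem_boundaryVertices_of_mem_star hyσ hyu

end PennyConfiguration

namespace PennyConfiguration

variable {V : Type*} {P : PennyConfiguration V} {σ : Set Plane}

theorem IsFace.encard_boundaryVertices_le (hσ : P.IsFace σ) :
    (P.boundaryVertices σ).encard ≤ P.facialDegree σ := by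
  have hcorner : ∀ u ∈ P.boundaryVertices σ, ∃ A, (u, A) ∈ P.corners σ := fun u hu => by
    obtain ⟨x, hxu, hxσ⟩ := mem_closure_iff.1 hu (P.penny u) Metric.isOpen_ball
      (Metric.mem_ball_self (by norm_num))
    have hx : x ∈ P.penny u \ P.skeleton := ⟨hxu, hσ.subset_compl_skeleton hxσ⟩
    exact ⟨connectedComponentIn (P.penny u \ P.skeleton) x, ⟨x, hx, rfl⟩,
      hσ.subset_of_isPreconnected isPreconnected_connectedComponentIn
        ((connectedComponentIn_subset _ _).trans fun _ h => h.2) hxσ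
        (mem_connectedComponentIn hx)⟩
  choose! A hA using hcorner
  exact encard_le_encard_of_injOn (f := fun u => (u, A u)) hA
    fun u _ v _ huv => congrArg Prod.fst huv

theorem joinedIn_skeleton_of_walk {v w : V} (p : P.graph.Walk v w) :
    JoinedIn P.skeleton (P.center v) (P.center w) := by
  induction p with
  | nil => exact JoinedIn.refl (P.center_mem_skeleton _)
  | @cons a b _ h _ ih =>
    exact (JoinedIn.of_segment_subset fun z hz => .inr ⟨a, b, h, hz⟩).trans ih

theorem isConnected_skeleton (hconn : P.graph.Connected) : IsConnected P.skeleton := by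
  obtain ⟨x⟩ := hconn.nonempty
  refine IsPathConnected.isConnected ⟨P.center x, P.center_mem_skeleton x, fun {z} hz => ?_⟩
  obtain ⟨v, w, hvw, hz⟩ := P.mem_skeleton_iff.1 hz
  obtain ⟨p⟩ := hconn.preconnected x v
  refine (joinedIn_skeleton_of_walk p).trans (JoinedIn.of_segment_subset fun y hy => ?_)
  exact P.mem_skeleton_iff.2 ⟨v, w, hvw,
    (convex_segment _ _).segment_subset (left_mem_segment _ _ _) hz hy⟩

theorem IsFace.isPreconnected_frontier (hσ : P.IsFace σ) (hconn : P.graph.Connected) :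
    IsPreconnected (frontier σ) := by
  obtain ⟨z, -, rfl⟩ := hσ
  exact isPreconnected_frontier_connectedComponentIn_compl P.isClosed_skeleton
    (isConnected_skeleton hconn)

theorem IsFace.frontier_subset_skeleton (hσ : P.IsFace σ) : frontier σ ⊆ P.skeleton := by
  obtain ⟨z, -, rfl⟩ := hσ
  exact frontier_connectedComponentIn_compl_subset P.isClosed_skeleton

theorem IsFace.center_mem_frontier (hσ : P.IsFace σ) {u : V} (hu : u ∈ P.boundaryVertices σ) :
    P.center u ∈ frontier σ := by
  rw [hσ.isOpen.frontier_eq]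
  exact ⟨hu, fun h => hσ.subset_compl_skeleton h (P.center_mem_skeleton u)⟩

theorem IsFace.exists_boundaryVertex_of_mem_frontier (hσ : P.IsFace σ) {q : Plane}
    (hq : q ∈ frontier σ) :
    ∃ u ∈ P.boundaryVertices σ, P.OnOpenEdge u q ∧ dist q (P.center u) ≤ 1 / 2 := by
  obtain ⟨u, hu, hd⟩ := P.exists_onOpenEdge (hσ.frontier_subset_skeleton hq)
  exact ⟨u, hσ.mem_boundaryVertices_of_mem_closure (frontier_subset_closure hq) (.inl hu), hu, hd⟩

theorem IsFace.reachable_induce_boundaryVertices (hσ : P.IsFace σ) (hconn : P.graph.Connected)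
    (u w : P.boundaryVertices σ) :
    (P.graph.induce (P.boundaryVertices σ)).Reachable u w := by
  have hcell : ∀ {q} {v v' : P.boundaryVertices σ}, P.OnOpenEdge v q → P.OnOpenEdge v' q →
      (P.graph.induce (P.boundaryVertices σ)).Reachable v v' := fun {q v v'} hv hv' => by
    rcases P.dist_le_one_iff.1 (hv.dist_le_one hv') with h | h
    · rw [Subtype.ext h]
    · exact SimpleGraph.Adj.reachable (G := P.graph.induce _) h
  refine (hσ.isPreconnected_frontier hconn).induction₂
    (fun q q' => ∀ v v' : P.boundaryVertices σ, P.OnOpenEdge v q → P.OnOpenEdge v' q' →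
      (P.graph.induce (P.boundaryVertices σ)).Reachable v v') ?_ ?_ ?_
    (hσ.center_mem_frontier u.2) (hσ.center_mem_frontier w.2) u w
    (P.onOpenEdge_center u) (P.onOpenEdge_center w)
  · intro q hq
    obtain ⟨a, ha, haq, -⟩ := hσ.exists_boundaryVertex_of_mem_frontier hq
    filter_upwards [mem_nhdsWithin_of_mem_nhds (isOpen_star.mem_nhds (.inl haq)),
      self_mem_nhdsWithin] with q' haq' hq' v v' hv hv'
    have haq' := onOpenEdge_of_mem_star haq' (hσ.frontier_subset_skeleton hq')
    exact (hcell hv (v' := ⟨a, ha⟩) haq).trans (hcell haq' hv')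
  · intro x y z _ hy _ hxy hyz v v' hv hv'
    obtain ⟨a, ha, hay, -⟩ := hσ.exists_boundaryVertex_of_mem_frontier hy
    exact (hxy v ⟨a, ha⟩ hv hay).trans (hyz ⟨a, ha⟩ v' hay hv')
  · exact fun x y _ _ hxy v v' hv hv' => (hxy v' v hv' hv).symm

theorem IsFace.dist_add_one_le_encard (hσ : P.IsFace σ) (hconn : P.graph.Connected) {u w : V}
    (hu : u ∈ P.boundaryVertices σ) (hw : w ∈ P.boundaryVertices σ) :
    (P.graph.dist u w + 1 : ℕ) ≤ (P.boundaryVertices σ).encard := by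
  rcases (P.boundaryVertices σ).finite_or_infinite with hfin | hinf
  · have := hfin.fintype
    obtain ⟨p, hp⟩ :=
      (hσ.reachable_induce_boundaryVertices hconn ⟨u, hu⟩ ⟨w, hw⟩).exists_isPath
    have hle := SimpleGraph.dist_le (p.map (SimpleGraph.Embedding.induce _).toHom)
    rw [SimpleGraph.Walk.length_map] at hle
    rw [encard, ENat.card_eq_coe_fintype_card, Nat.cast_le]
    exact hle.trans_lt hp.length_lt
  · rw [hinf.encard_eq]
    exact le_top

end PennyConfiguration

namespace PennyConfiguration

variable {V : Type*} {P : PennyConfiguration V} {u w y : V}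

theorem dist_add_one_le_of_star_inter_star {n : ℕ}
    (hn : ∀ σ, P.IsFace σ → (P.boundaryVertices σ).encard ≤ n) (hconn : P.graph.Connected)
    (h : (P.star u ∩ P.star w).Nonempty) : P.graph.dist u w + 1 ≤ n := by
  obtain ⟨z, hz, hzS⟩ : ((P.star u ∩ P.star w) \ P.skeleton).Nonempty := by
    rw [sdiff_nonempty]
    intro hsub
    have hint := interior_mono hsub
    rw [P.interior_skeleton, (isOpen_star.inter isOpen_star).interior_eq] at hint
    exact h.ne_empty (subset_empty_iff.1 hint)
  obtain ⟨σ, hσ, hzσ⟩ := P.exists_isFace_mem hzS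
  exact_mod_cast (hσ.dist_add_one_le_encard hconn (hσ.mem_boundaryVertices_of_mem_star hzσ hz.1)
    (hσ.mem_boundaryVertices_of_mem_star hzσ hz.2)).trans (hn σ hσ)

theorem mem_skeleton_of_mem_frontier_iUnion_star {s : Set V} {q : Plane}
    (hq : q ∈ frontier (⋃ v ∈ s, P.star v)) : q ∈ P.skeleton := by
  rw [(isOpen_biUnion fun v _ => isOpen_star).frontier_eq] at hq
  by_contra hqS
  obtain ⟨σ, hσ, hqσ⟩ := P.exists_isFace_mem hqS
  obtain ⟨x, hxσ, hx⟩ := mem_closure_iff.1 hq.1 σ hσ.isOpen hqσ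
  obtain ⟨v, hv, hxv⟩ := mem_iUnion₂.1 hx
  exact hq.2 (mem_biUnion hv (.inr ⟨σ, hσ, hqσ, hσ.mem_boundaryVertices_of_mem_star hxσ hxv⟩))

theorem OnOpenEdge.exists_hop {p : Plane} (hu : P.OnOpenEdge u p) (hy : ¬ P.OnOpenEdge y p) :
    ∃ q ∈ segment ℝ p (P.center y), ∃ v w, P.OnOpenEdge v p ∧ P.OnOpenEdge w q ∧
      (P.star v ∩ P.star w).Nonempty ∧ 2 / 3 ≤ dist p q := by
  set U := ⋃ v ∈ {v | P.OnOpenEdge v p}, P.star v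
  have hpU : p ∈ U := mem_biUnion (x := u) hu (.inl hu)
  have hyU : P.center y ∉ U := fun h => by
    obtain ⟨v, hv, hyv⟩ := mem_iUnion₂.1 h
    exact hy ((onOpenEdge_of_mem_star hyv (P.center_mem_skeleton y)).eq_of_center ▸ hv)
  obtain ⟨q, hq, hqU⟩ := nonempty_inter_frontier_of_isPreconnected
    (convex_segment p (P.center y)).isPreconnected ⟨p, left_mem_segment _ _ _, hpU⟩
    ⟨P.center y, right_mem_segment _ _ _, hyU⟩
  obtain ⟨w, hw, -⟩ := P.exists_onOpenEdge (mem_skeleton_of_mem_frontier_iUnion_star hqU)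
  rw [(isOpen_biUnion fun v _ => isOpen_star).frontier_eq] at hqU
  obtain ⟨x, hxw, hxU⟩ := mem_closure_iff.1 hqU.1 _ isOpen_star (.inl hw : q ∈ P.star w)
  obtain ⟨v, hv, hxv⟩ := mem_iUnion₂.1 hxU
  exact ⟨q, hq, v, w, hv, hw, ⟨x, hxv, hxw⟩, hu.two_thirds_le_dist hw fun v hv hvq =>
    hqU.2 (mem_biUnion (x := v) hv (.inl hvq))⟩

theorem OnOpenEdge.graph_dist_le_one {p : Plane} (hu : P.OnOpenEdge u p)
    (hw : P.OnOpenEdge w p) : P.graph.dist u w ≤ 1 := by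
  rcases P.dist_le_one_iff.1 (hu.dist_le_one hw) with rfl | h
  · simp
  · exact (SimpleGraph.dist_eq_one_iff_adj.2 h).le

theorem OnOpenEdge.exists_combDist_le {n : ℕ}
    (hn : ∀ σ, P.IsFace σ → (P.boundaryVertices σ).encard ≤ n) (hconn : P.graph.Connected)
    {p : Plane} (hu : P.OnOpenEdge u p) (y : V) :
    ∃ v, P.OnOpenEdge v p ∧ P.combDist v y ≤ 2 * n * dist p (P.center y) := by
  obtain ⟨k, hk⟩ := exists_nat_gt (2 * dist p (P.center y))
  induction k generalizing u p with
  | zero => exact absurd hk (by simp)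
  | succ k ih =>
    by_cases hy : P.OnOpenEdge y p
    · refine ⟨y, hy, ?_⟩
      rw [combDist, SimpleGraph.dist_self, Nat.cast_zero]
      positivity
    obtain ⟨q, hq, v, w, hv, hw, hvw, hpq⟩ := hu.exists_hop hy
    have hsum := dist_add_dist_of_mem_segment hq
    push_cast at hk
    obtain ⟨w', hw', hdist⟩ := ih hw (by linarith)
    refine ⟨v, hv, ?_⟩
    have hvy : P.combDist v y ≤ n + P.combDist w' y := by
      have hvw := dist_add_one_le_of_star_inter_star hn hconn hvw
      have hvy : P.graph.dist v y ≤ n + P.graph.dist w' y := by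
        have := hw.graph_dist_le_one hw'
        have := hconn.dist_triangle (u := v) (v := w) (w := w')
        have := hconn.dist_triangle (u := v) (v := w') (w := y)
        omega
      simpa only [combDist, ← Nat.cast_add, Nat.cast_le]
    have hmul : 2 * n * (1 / 2) ≤ 2 * n * dist p q := by
      gcongr
      linarith
    rw [← hsum, mul_add]
    linarith

theorem combDist_le {n : ℕ} (hn : ∀ σ, P.IsFace σ → (P.boundaryVertices σ).encard ≤ n)
    (hconn : P.graph.Connected) (x y : V) :
    P.combDist x y ≤ 2 * n * dist (P.center x) (P.center y) := by
  obtain ⟨v, hv, hle⟩ := (P.onOpenEdge_center x).exists_combDist_le hn hconn y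
  rwa [hv.eq_of_center] at hle

theorem dist_center_le_combDist (hconn : P.graph.Connected) (x y : V) :
    dist (P.center x) (P.center y) ≤ P.combDist x y := by
  have hwalk : ∀ {v w} (p : P.graph.Walk v w), dist (P.center v) (P.center w) ≤ p.length :=
    fun {v w} p => by
    induction p with
    | nil => simp
    | @cons a b c h p ih =>
      rw [SimpleGraph.Walk.length_cons, Nat.cast_add_one]
      linarith [dist_triangle (P.center a) (P.center b) (P.center c), P.adj_iff.1 h]
  obtain ⟨p, hp⟩ := hconn.exists_walk_length_eq_dist x y
  exact (hwalk p).trans_eq (congrArg _ hp)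

theorem IsFace.isBounded [Infinite V] {σ : Set Plane} (hσ : P.IsFace σ)
    (hfin : (P.boundaryVertices σ).Finite) : Bornology.IsBounded σ := by
  have hfrontier : Bornology.IsBounded (frontier σ) := by
    refine ((Bornology.isBounded_biUnion hfin).2 fun u _ =>
      Metric.isBounded_closedBall (x := P.center u) (r := 1 / 2)).subset fun q hq => ?_
    obtain ⟨u, hu, -, hqu⟩ := hσ.exists_boundaryVertex_of_mem_frontier hq
    exact mem_biUnion hu hqu
  refine (isBounded_or_isBounded_compl_of_frontier
    (by rw [← Module.finrank_eq_rank]; simp) hfrontier).resolve_right fun hbdd => ?_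
  obtain ⟨r, hr⟩ := hbdd.subset_closedBall 0
  refine infinite_univ ((P.finite_setOf_dist_le 0 r).subset fun v _ => hr fun hv => ?_)
  exact hσ.subset_compl_skeleton hv (P.center_mem_skeleton v)

theorem IsFace.boundaryVertices_nonempty [Nonempty V] {σ : Set Plane} (hσ : P.IsFace σ) :
    (P.boundaryVertices σ).Nonempty := by
  obtain ⟨z, hz, rfl⟩ := id hσ
  obtain ⟨v⟩ := ‹Nonempty V›
  have hne : connectedComponentIn P.skeletonᶜ z ≠ univ := fun h =>
    hσ.subset_compl_skeleton (h ▸ mem_univ (P.center v)) (P.center_mem_skeleton v)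
  obtain ⟨q, hq⟩ := nonempty_frontier_iff.2 ⟨⟨z, mem_connectedComponentIn hz⟩, hne⟩
  obtain ⟨u, hu, -⟩ := hσ.exists_boundaryVertex_of_mem_frontier hq
  exact ⟨u, hu⟩

theorem IsFace.exists_dist_center_le [Infinite V] {σ : Set Plane} (hσ : P.IsFace σ) {n : ℕ}
    (hn : (P.boundaryVertices σ).encard ≤ n) (hconn : P.graph.Connected) {z : Plane}
    (hz : z ∈ σ) : ∃ x, dist z (P.center x) ≤ n / 2 := by
  obtain ⟨u, hu⟩ := hσ.boundaryVertices_nonempty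
  have huz : P.center u ≠ z := fun h =>
    hσ.subset_compl_skeleton (h ▸ hz) (P.center_mem_skeleton u)
  obtain ⟨q, hq, huzq⟩ := exists_wbtw_mem_frontier_of_isBounded
    (hσ.isBounded (finite_of_encard_le_coe hn)) huz hz
  obtain ⟨w, hw, -, hqw⟩ := hσ.exists_boundaryVertex_of_mem_frontier hq
  have huw : dist (P.center u) (P.center w) ≤ n - 1 := by
    have hdist : P.graph.dist u w + 1 ≤ n := by
      exact_mod_cast (hσ.dist_add_one_le_encard hconn hu hw).trans hn
    have hcast : P.combDist u w + 1 ≤ n := by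
      simpa only [combDist, ← Nat.cast_add_one, Nat.cast_le]
    linarith [dist_center_le_combDist hconn u w]
  have hsum := huzq.dist_add_dist
  have huq := dist_triangle_right (P.center u) q (P.center w)
  have hzw := dist_triangle z q (P.center w)
  rcases le_total (dist z (P.center u)) (n / 2) with hle | hge
  · exact ⟨u, hle⟩
  · rw [dist_comm] at hge
    exact ⟨w, by linarith⟩

theorem one_le_of_encard_boundaryVertices_le [Nonempty V] {n : ℕ}
    (hn : ∀ σ, P.IsFace σ → (P.boundaryVertices σ).encard ≤ n) (hconn : P.graph.Connected) :
    1 ≤ n := by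
  obtain ⟨x⟩ := ‹Nonempty V›
  exact le_of_add_le_right (dist_add_one_le_of_star_inter_star hn hconn (u := x) (w := x)
    ⟨P.center x, .inl (P.onOpenEdge_center x), .inl (P.onOpenEdge_center x)⟩)

theorem exists_dist_center_le [Infinite V] {n : ℕ}
    (hn : ∀ σ, P.IsFace σ → (P.boundaryVertices σ).encard ≤ n) (hconn : P.graph.Connected)
    (z : Plane) : ∃ x, dist z (P.center x) ≤ n / 2 := by
  by_cases hz : z ∈ P.skeleton
  · obtain ⟨x, -, hdist⟩ := P.exists_onOpenEdge hz
    have : (1 : ℝ) ≤ n := by exact_mod_cast one_le_of_encard_boundaryVertices_le hn hconn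
    exact ⟨x, by linarith⟩
  · obtain ⟨σ, hσ, hzσ⟩ := P.exists_isFace_mem hz
    exact hσ.exists_dist_center_le (hn σ hσ) hconn hzσ

end PennyConfiguration

theorem isQuasiIsometryMap_of_le {X Y : Type*} {dX : X → X → ℝ} {dY : Y → Y → ℝ} {ψ : X → Y}
    {a C : ℝ} (ha : 1 ≤ a) (hC : 0 < C) (hlower : ∀ x₁ x₂, dX x₁ x₂ ≤ a * dY (ψ x₁) (ψ x₂))
    (hupper : ∀ x₁ x₂, dY (ψ x₁) (ψ x₂) ≤ a * dX x₁ x₂) (hdense : ∀ y, ∃ x, dY y (ψ x) < C) :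
    IsQuasiIsometryMap dX dY ψ := by
  refine ⟨a, C, ha, hC, fun x₁ x₂ => ⟨?_, by linarith [hupper x₁ x₂]⟩, hdense⟩
  linarith [(inv_mul_le_iff₀ (zero_lt_one.trans_le ha)).2 (hlower x₁ x₂)]

theorem le_floor_of_toENNReal_le {m : ℕ∞} {D : ℝ≥0} (h : (m : ℝ≥0∞) ≤ D) : m ≤ ⌊D⌋₊ := by
  obtain ⟨k, rfl⟩ := ENat.ne_top_iff_exists.1 fun hm : m = ⊤ =>
    ENNReal.coe_ne_top (top_le_iff.1 (by simpa only [hm, ENat.toENNReal_top] using h))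
  rw [ENat.toENNReal_coe, ← ENNReal.coe_natCast, ENNReal.coe_le_coe] at h
  exact Nat.cast_le.2 (Nat.le_floor h)

theorem theorem3p2_general {V : Type*} [Infinite V] (P : PennyConfiguration V)
    (hconn : P.graph.Connected) (D : ℝ≥0)
    (hD : ∀ σ : Set Plane, P.IsFace σ → ((P.boundaryVertices σ).encard : ℝ≥0∞) ≤ (D : ℝ≥0∞)) :
    (∀ x y : V, 1 / (2 * (D : ℝ)) * P.combDist x y ≤ dist (P.center x) (P.center y) ∧
      dist (P.center x) (P.center y) ≤ P.combDist x y) ∧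
    (∀ z : Plane, ∃ x : V, dist z (P.center x) ≤ (D : ℝ) / 2) ∧
    IsQuasiIsometryMap P.combDist (dist : Plane → Plane → ℝ) P.center := by
  have hn : ∀ σ, P.IsFace σ → (P.boundaryVertices σ).encard ≤ ⌊D⌋₊ := fun σ hσ =>
    le_floor_of_toENNReal_le (hD σ hσ)
  have hnD : (⌊D⌋₊ : ℝ) ≤ D := by exact_mod_cast Nat.floor_le D.2
  have hD1 : (1 : ℝ) ≤ D := le_trans
    (by exact_mod_cast PennyConfiguration.one_le_of_encard_boundaryVertices_le hn hconn) hnD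
  have hlower : ∀ x y, P.combDist x y ≤ 2 * D * dist (P.center x) (P.center y) := fun x y =>
    (PennyConfiguration.combDist_le hn hconn x y).trans (by gcongr)
  have hupper := PennyConfiguration.dist_center_le_combDist hconn
  have hdense : ∀ z, ∃ x, dist z (P.center x) ≤ (D : ℝ) / 2 := fun z =>
    (PennyConfiguration.exists_dist_center_le hn hconn z).imp fun _ h => h.trans (by gcongr)
  refine ⟨fun x y => ⟨?_, hupper x y⟩, hdense, ?_⟩
  · rw [one_div, inv_mul_le_iff₀ (by linarith)]
    exact hlower x y
  · refine isQuasiIsometryMap_of_le (by linarith) (by linarith : 0 < (D : ℝ)) hlower ?_ ?_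
    · exact fun x y => (hupper x y).trans (le_mul_of_one_le_left (Nat.cast_nonneg _) (by linarith))
    · exact fun z => (hdense z).imp fun _ h => by linarith

theorem theorem3p2 {V : Type*} [Infinite V] (P : PennyConfiguration V)
    (hconn : P.graph.Connected) (D : ℝ≥0)
    (hD : ∀ σ : Set Plane, P.IsFace σ → (P.facialDegree σ : ℝ≥0∞) ≤ (D : ℝ≥0∞)) :
    (∀ x y : V, 1 / (2 * (D : ℝ)) * P.combDist x y ≤ dist (P.center x) (P.center y) ∧
      dist (P.center x) (P.center y) ≤ P.combDist x y) ∧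
    (∀ z : Plane, ∃ x : V, dist z (P.center x) ≤ (D : ℝ) / 2) ∧
    IsQuasiIsometryMap P.combDist (dist : Plane → Plane → ℝ) P.center :=
  theorem3p2_general P hconn D fun σ hσ =>
    (ENat.toENNReal_le.2 hσ.encard_boundaryVertices_le).trans (hD σ hσ)
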